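/- Let $G$ be a simple, connected, finite and planar graph with $n$ vertices that contains at least one cycle. Suppose that the girth of $G$ (the length of a shortest cycle) and the circumference of $G$ (the length of a longest cycle) are equal, and let $r = \mathrm{girth}(G) = \mathrm{circum}(G)$ be their common value. If $r$ is even and $n \geq 4$, then \[|E(G)| \leq n-1+\left\lfloor\frac{n-\frac{r}{2}-1}{\frac{r}{2}-1}\right\rfloor,\] and if $r$ is odd and $n \geq 3$, then \[|E(G)| \leq n-1+\left\lfloor\frac{n-1}{r-1}\right\rfloor.\] -/

import Mathlib

namespace SimpleGraph

/-- The circumference of a graph: the length of a longest cycle. Like `SimpleGraph.girth`, it takes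
the default value `0` when the graph has no cycle. On a finite graph the set of cycle lengths is
bounded, so the supremum is a maximum as soon as there is a cycle. -/
noncomputable def circumference {V : Type*} (G : SimpleGraph V) : ℕ :=
  sSup {l : ℕ | ∃ (v : V) (c : G.Walk v v), c.IsCycle ∧ c.length = l}

/-- A plane representation of a finite graph: vertices are sent to distinct points of the Euclidean
plane, each edge to a simple arc joining the points of its two ends, and an arc meets the vertex
points and the other arcs only at its own ends. -/
structure PlaneRepresentation {V : Type*} (G : SimpleGraph V) where
  point : V → EuclideanSpace ℝ (Fin 2)
  point_injective : Function.Injective point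
  arc : G.edgeSet → unitInterval → EuclideanSpace ℝ (Fin 2)
  arc_continuous : ∀ e, Continuous (arc e)
  arc_injective : ∀ e, Function.Injective (arc e)
  arc_ends : ∀ e : G.edgeSet, s(arc e 0, arc e 1) = Sym2.map point (e : Sym2 V)
  arc_vertex : ∀ (e : G.edgeSet) (t : unitInterval) (v : V),
    arc e t = point v → t = 0 ∨ t = 1
  arc_arc : ∀ (e f : G.edgeSet) (t u : unitInterval),
    e ≠ f → arc e t = arc f u → t = 0 ∨ t = 1

/-- A (finite) graph is planar if it can be embedded in the Euclidean plane. -/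
def IsPlanar {V : Type*} (G : SimpleGraph V) : Prop :=
  Nonempty G.PlaneRepresentation

end SimpleGraph

namespace SimpleGraph

variable {V : Type*} {G : SimpleGraph V}

namespace Walk

/-! Every cycle has length r. In a normal spanning tree each non-tree edge joins a vertex u to an
ancestor and closes a tree path into a cycle, so that ancestor is `par^[r - 1] u`. With b such back
edges, |E| ≤ n - 1 + b, and it remains to bound b.

If the tree paths of two back edges overlap below their upper ends, both edges and pieces of the
tree form a cycle of length 2q + 2, with q the distance from the deeper lower end to the meeting
point; hence r = 2q + 2 (`exists_of_overlap`). For odd r this is impossible, so the b paths give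
disjoint blocks of r - 1 vertices missing the root: b(r - 1) + 1 ≤ n. For r = 2k only the lowest k -
1 vertices of each path are sure to be disjoint, but the path of a shallowest back end adds k more,
and the root one: b(k - 1) + k + 1 ≤ n. -/

theorem IsPath.append_of_support_inter {a b c : V} {p : G.Walk a b} {q : G.Walk b c}
    (hp : p.IsPath) (hq : q.IsPath) (h : ∀ x ∈ p.support, x ∈ q.support → x = b) :
    (p.append q).IsPath := by
  induction p with
  | nil => simpa using hq
  | cons hadj p ih =>
    rw [cons_isPath_iff] at hp
    rw [cons_append, cons_isPath_iff]
    refine ⟨ih hp.1 hq fun x hx => h x (by simp [hx]), fun hmem => ?_⟩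
    rcases (mem_support_append_iff _ _).1 hmem with h1 | h1
    · exact hp.2 h1
    · have := h _ (by simp) h1
      subst this
      exact hp.2 p.end_mem_support

end Walk

/-- `par` and `depth` are the parent and depth functions of a spanning tree of `G` with root
`root`; the parent of the root is the root itself. -/
structure IsRootedTree (G : SimpleGraph V) (root : V) (par : V → V) (depth : V → ℕ) : Prop where
  par_root : par root = root
  depth_root : depth root = 0
  adj_par : ∀ v, v ≠ root → G.Adj v (par v)
  depth_par : ∀ v, v ≠ root → depth v = depth (par v) + 1

/-! ### Rooted spanning trees and rehanging. -/

namespace IsRootedTree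

variable {root : V} {par : V → V} {depth : V → ℕ}

theorem depth_iterate (h : G.IsRootedTree root par depth) (i : ℕ) (v : V) :
    depth (par^[i] v) = depth v - i := by
  induction i generalizing v with
  | zero => simp
  | succ i ih =>
    rw [Function.iterate_succ_apply, ih]
    by_cases hv : v = root
    · subst hv; rw [h.par_root, h.depth_root]; omega
    · have := h.depth_par v hv; omega

theorem eq_root_of_depth_eq_zero (h : G.IsRootedTree root par depth) {v : V} (hv : depth v = 0) :
    v = root := by
  by_contra hne
  have := h.depth_par v hne
  omega

theorem ne_root_of_depth_pos (h : G.IsRootedTree root par depth) {v : V} (hv : 0 < depth v) :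
    v ≠ root := by
  rintro rfl
  have := h.depth_root
  omega

/-- Depth drops at each step, so no vertex repeats. The description of the support lets disjointness
of tree segments be checked by depth. -/
theorem exists_ascending_path (h : G.IsRootedTree root par depth) (i : ℕ) (v : V)
    (hi : i ≤ depth v) :
    ∃ p : G.Walk v (par^[i] v), p.IsPath ∧ p.length = i ∧
      ∀ x ∈ p.support, ∃ j ≤ i, x = par^[j] v := by
  induction i generalizing v with
  | zero => exact ⟨Walk.nil, by simp, by simp, fun x hx => ⟨0, le_rfl, by simpa using hx⟩⟩
  | succ i ih =>
    have hv := h.ne_root_of_depth_pos (v := v) (by omega)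
    have hd := h.depth_par v hv
    obtain ⟨p, hp, hl, hs⟩ := ih (par v) (by omega)
    refine ⟨Walk.cons (h.adj_par v hv) p, ?_, by simp [hl], ?_⟩
    · refine (Walk.cons_isPath_iff _ _).2 ⟨hp, fun hmem => ?_⟩
      obtain ⟨j, -, hj⟩ := hs v hmem
      have := h.depth_iterate j (par v)
      rw [← hj] at this
      omega
    · intro x hx
      change x ∈ v :: p.support at hx
      rw [List.mem_cons] at hx
      rcases hx with rfl | hx
      · exact ⟨0, by omega, rfl⟩
      · obtain ⟨j, hj, rfl⟩ := hs x hx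
        exact ⟨j + 1, by omega, rfl⟩

theorem depth_lt_card [Fintype V] (h : G.IsRootedTree root par depth) (v : V) :
    depth v < Fintype.card V := by
  obtain ⟨p, hp, hl, -⟩ := h.exists_ascending_path _ v le_rfl
  exact hl ▸ hp.length_lt

/-- Hanging the subtree of `x` below a neighbour `y` of `x` that lies outside it. -/
theorem exists_rehang (h : G.IsRootedTree root par depth) {x y : V} (hxy : G.Adj x y)
    (hle : depth x ≤ depth y) (hx : x ≠ root) (hy : ∀ i, par^[i] y ≠ x) :
    ∃ par' depth', G.IsRootedTree root par' depth' ∧ depth ≤ depth' ∧ depth x < depth' x := by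
  classical
  -- Away from `x`, a vertex and its parent are both inside or both outside the subtree of `x`, so
  -- their depths shift together.
  have hsub (v : V) (hv : v ≠ x) : (∃ i, par^[i] (par v) = x) ↔ ∃ i, par^[i] v = x := by
    constructor
    · rintro ⟨i, hi⟩; exact ⟨i + 1, hi⟩
    · rintro ⟨_ | i, hi⟩
      · exact absurd hi hv
      · exact ⟨i, hi⟩
  have hroot : ¬ ∃ i, par^[i] root = x := by
    rintro ⟨i, hi⟩
    exact hx (hi ▸ Function.iterate_fixed h.par_root i)
  refine ⟨Function.update par x y,
    -- The shift brings `x` to depth `depth y + 1`; it is positive because `depth x ≤ depth y`.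
    fun v => if ∃ i, par^[i] v = x then depth v + (depth y + 1 - depth x) else depth v,
    ⟨?_, ?_, ?_, ?_⟩, ?_, ?_⟩
  · rw [Function.update_of_ne hx.symm, h.par_root]
  · simp only [if_neg hroot, h.depth_root]
  · intro v hv
    by_cases hvx : v = x
    · subst hvx; simpa using hxy
    · simpa [hvx] using h.adj_par v hv
  · intro v hv
    by_cases hvx : v = x
    · subst hvx
      have h1 : ∃ i, par^[i] v = v := ⟨0, rfl⟩
      have h2 : ¬ ∃ i, par^[i] y = v := by push Not; exact hy
      simp only [Function.update_self, if_pos h1, if_neg h2]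
      omega
    · have := h.depth_par v hv
      simp only [Function.update_of_ne hvx, hsub v hvx]
      split_ifs <;> omega
  · intro v
    dsimp only
    split_ifs <;> omega
  · have h1 : ∃ i, par^[i] x = x := ⟨0, rfl⟩
    simp only [if_pos h1]
    omega

end IsRootedTree

/-! ### Existence of a normal spanning tree. -/

theorem Connected.exists_isRootedTree (hG : G.Connected) (root : V) :
    ∃ par depth, G.IsRootedTree root par depth := by
  classical
  -- Breadth-first choice of parent: the next vertex on a geodesic to the root.
  have key (v : V) : ∃ w, v ≠ root → G.Adj v w ∧ G.dist v root = G.dist w root + 1 := by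
    by_cases hv : v = root
    · exact ⟨v, fun h => absurd hv h⟩
    · obtain ⟨p, hp⟩ := hG.exists_walk_length_eq_dist v root
      cases p with
      | nil => exact absurd rfl hv
      | @cons _ w _ hadj q =>
        refine ⟨w, fun _ => ⟨hadj, ?_⟩⟩
        have h1 := dist_le q
        have h2 := hG.dist_triangle (u := v) (v := w) (w := root)
        rw [dist_eq_one_iff_adj.2 hadj] at h2
        rw [Walk.length_cons] at hp
        omega
  choose f hf using key
  refine ⟨fun v => if v = root then root else f v, fun v => G.dist v root, by simp, by simp, ?_, ?_⟩
  · intro v hv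
    simpa [hv] using (hf v hv).1
  · intro v hv
    simpa [hv] using (hf v hv).2

/-- A finite connected graph has a normal spanning tree: the ends of every edge are comparable. -/
theorem Connected.exists_normal_isRootedTree [Fintype V] (hG : G.Connected) (root : V) :
    ∃ par depth, G.IsRootedTree root par depth ∧
      ∀ x y, G.Adj x y → (∃ i, par^[i] x = y) ∨ ∃ i, par^[i] y = x := by
  -- A tree of maximal total depth is normal: an edge with incomparable ends would allow a rehanging
  -- that increases the sum.
  let P : ℕ → Prop := fun s => ∃ par depth, G.IsRootedTree root par depth ∧ ∑ v, depth v = s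
  have hbound (s : ℕ) (hs : P s) : s ≤ Fintype.card V * Fintype.card V := by
    obtain ⟨par, depth, h, rfl⟩ := hs
    simpa using Finset.sum_le_card_nsmul Finset.univ depth _ fun v _ => (h.depth_lt_card v).le
  obtain ⟨par₀, depth₀, h₀⟩ := hG.exists_isRootedTree root
  classical
  have hP : P (Nat.findGreatest P (Fintype.card V * Fintype.card V)) :=
    Nat.findGreatest_spec (hbound _ ⟨par₀, depth₀, h₀, rfl⟩) ⟨par₀, depth₀, h₀, rfl⟩
  obtain ⟨par, depth, h, hmax⟩ := hP
  have main (x y : V) (hxy : G.Adj x y) (hle : depth x ≤ depth y) (hy : ∀ i, par^[i] y ≠ x) :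
      False := by
    have hx : x ≠ root := by
      rintro rfl
      exact hy (depth y) (h.eq_root_of_depth_eq_zero (by rw [h.depth_iterate]; omega))
    obtain ⟨par', depth', h', hle', hlt⟩ := h.exists_rehang hxy hle hx hy
    have h1 : ∑ v, depth v < ∑ v, depth' v :=
      Finset.sum_lt_sum (fun v _ => hle' v) ⟨x, Finset.mem_univ x, hlt⟩
    have h2 : P (∑ v, depth' v) := ⟨par', depth', h', rfl⟩
    have := Nat.le_findGreatest (hbound _ h2) h2
    omega
  refine ⟨par, depth, h, fun x y hxy => ?_⟩
  by_contra hcon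
  push Not at hcon
  rcases le_total (depth x) (depth y) with hle | hle
  · exact main x y hxy hle hcon.2
  · exact main y x hxy.symm hle hcon.1

/-! ### Back edges and the cycles they create. -/

namespace IsRootedTree

variable {root : V} {par : V → V} {depth : V → ℕ} {r : ℕ}

/-- `u` is the lower end of an edge of `G` that jumps up by `r - 1` levels in a rooted tree. -/
def IsBackEnd (G : SimpleGraph V) (par : V → V) (depth : V → ℕ) (r : ℕ) (u : V) : Prop :=
  r - 1 ≤ depth u ∧ G.Adj u (par^[r - 1] u)

theorem edge_cases (h : G.IsRootedTree root par depth)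
    (hcyc : ∀ (v : V) (c : G.Walk v v), c.IsCycle → c.length = r)
    {x y : V} (hxy : G.Adj x y) (hex : ∃ i, par^[i] x = y) :
    x ≠ root ∧ (y = par x ∨ IsBackEnd G par depth r x ∧ y = par^[r - 1] x) := by
  -- Iterates of `par` stay at the root once there, so `i` can be capped at `depth x`.
  obtain ⟨i, hi, rfl⟩ : ∃ i ≤ depth x, par^[i] x = y := by
    obtain ⟨i, rfl⟩ := hex
    rcases le_total i (depth x) with hle | hle
    · exact ⟨i, hle, rfl⟩
    · refine ⟨depth x, le_rfl, ?_⟩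
      rw [h.eq_root_of_depth_eq_zero (v := par^[depth x] x) (by rw [h.depth_iterate]; omega),
        h.eq_root_of_depth_eq_zero (v := par^[i] x) (by rw [h.depth_iterate]; omega)]
  have hi0 : i ≠ 0 := by
    rintro rfl
    exact hxy.ne rfl
  refine ⟨h.ne_root_of_depth_pos (by omega), ?_⟩
  by_cases hi1 : i = 1
  · subst hi1; exact Or.inl rfl
  obtain ⟨p, hp, hl, -⟩ := h.exists_ascending_path i x hi
  have hc : (Walk.cons hxy.symm p).IsCycle := by
    rw [Walk.isCycle_iff_isPath_tail_and_le_length]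
    refine ⟨by simpa using hp, ?_⟩
    rw [Walk.length_cons]
    omega
  have := hcyc _ _ hc
  rw [Walk.length_cons] at this
  obtain rfl : i = r - 1 := by omega
  exact Or.inr ⟨⟨hi, hxy⟩, rfl⟩

/-- The cycle climbs from v to the meeting point (q), descends to u (p), takes the back edge of u
(1), descends from its upper end to that of v (q - p), and returns by the back edge of v (1): 2q + 2
in all. -/
theorem eq_of_meet_of_le (h : G.IsRootedTree root par depth)
    (hcyc : ∀ (v : V) (c : G.Walk v v), c.IsCycle → c.length = r)
    {u v : V} (hu : IsBackEnd G par depth r u) (hv : IsBackEnd G par depth r v) {p q : ℕ}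
    (hq0 : 0 < q) (hpq : p ≤ q) (hq : q < r - 1) (hmeet : par^[p] u = par^[q] v)
    (hdisj : ∀ i < p, ∀ j, par^[i] u ≠ par^[j] v) :
    r = 2 * q + 2 := by
  obtain ⟨hud, hua⟩ := hu
  obtain ⟨hvd, hva⟩ := hv
  have hdw : depth u - p = depth v - q := by
    rw [← h.depth_iterate, ← h.depth_iterate, hmeet]
  obtain ⟨A, hA, hAl, hAs⟩ := h.exists_ascending_path q v (by omega)
  obtain ⟨B, hB, hBl, hBs⟩ := h.exists_ascending_path p u (by omega)
  obtain ⟨C, hC, hCl, hCs⟩ := h.exists_ascending_path (q - p) (par^[r - 1] v)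
    (by rw [h.depth_iterate]; omega)
  have hend : par^[q - p] (par^[r - 1] v) = par^[r - 1] u := by
    rw [← Function.iterate_add_apply, show q - p + (r - 1) = r - 1 - p + q by omega,
      Function.iterate_add_apply, ← hmeet, ← Function.iterate_add_apply,
      show r - 1 - p + p = r - 1 by omega]
  have hAB : (A.append (B.reverse.copy hmeet rfl)).IsPath := by
    refine hA.append_of_support_inter (by simpa using hB.reverse) fun x hxA hxB => ?_
    obtain ⟨j, -, rfl⟩ := hAs x hxA
    obtain ⟨i, hi, hij⟩ := hBs _ (by simpa using hxB)
    rcases hi.lt_or_eq with hi | rfl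
    · exact absurd hij.symm (hdisj i hi j)
    · rw [hij, hmeet]
  have hD : (Walk.cons hua (C.reverse.copy hend rfl)).IsPath := by
    rw [Walk.cons_isPath_iff]
    refine ⟨by simpa using hC.reverse, fun hmem => ?_⟩
    obtain ⟨j, -, hj⟩ := hCs u (by simpa using hmem)
    have h1 := congrArg depth hj
    rw [h.depth_iterate, h.depth_iterate] at h1
    omega
  -- As `q < r - 1`, all of `C` has smaller depth than the meeting point, hence than every vertex of
  -- `A` and `B`.
  have hP : ((A.append (B.reverse.copy hmeet rfl)).append
      (Walk.cons hua (C.reverse.copy hend rfl))).IsPath := by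
    refine hAB.append_of_support_inter hD fun x hx hxD => ?_
    rw [Walk.support_cons, List.mem_cons] at hxD
    rcases hxD with rfl | hxD
    · rfl
    obtain ⟨j, -, rfl⟩ := hCs x (by simpa using hxD)
    rcases (Walk.mem_support_append_iff _ _).1 hx with hx | hx
    · obtain ⟨i, hi, hij⟩ := hAs _ hx
      have h1 := congrArg depth hij
      rw [h.depth_iterate, h.depth_iterate, h.depth_iterate] at h1
      omega
    · obtain ⟨i, hi, hij⟩ := hBs _ (by simpa using hx)
      have h1 := congrArg depth hij
      rw [h.depth_iterate, h.depth_iterate, h.depth_iterate] at h1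
      omega
  have hc : (Walk.cons hva.symm ((A.append (B.reverse.copy hmeet rfl)).append
      (Walk.cons hua (C.reverse.copy hend rfl)))).IsCycle := by
    rw [Walk.isCycle_iff_isPath_tail_and_le_length]
    refine ⟨by simpa using hP, ?_⟩
    simp only [Walk.length_cons, Walk.length_append, Walk.length_copy, Walk.length_reverse]
    by_contra hlt
    omega
  have := hcyc _ _ hc
  simp only [Walk.length_cons, Walk.length_append, Walk.length_copy, Walk.length_reverse] at this
  omega

/-- If the tree paths below two back edges overlap, then they meet exactly `r / 2 - 1` levels above
the deeper of the two lower ends. -/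
theorem exists_of_overlap (h : G.IsRootedTree root par depth)
    (hcyc : ∀ (v : V) (c : G.Walk v v), c.IsCycle → c.length = r)
    {u v : V} (hu : IsBackEnd G par depth r u) (hv : IsBackEnd G par depth r v) (huv : u ≠ v)
    {i j : ℕ} (hi : i < r - 1) (hj : j < r - 1) (hij : par^[i] u = par^[j] v) :
    ∃ q, r = 2 * q + 2 ∧ (q ≤ i ∨ q ≤ j) := by
  classical
  -- The bound `q ≤ depth v` excludes iterates stalled at the root, for which truncated subtraction
  -- would lose information. The least `p` gives the first meeting point.
  have hex : ∃ p, ∃ q, q ≤ depth v ∧ par^[p] u = par^[q] v := ⟨i, j, by have := hv.1; omega, hij⟩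
  have hu1 := hu.1
  have hv1 := hv.1
  obtain ⟨p, hp, hmin⟩ : ∃ p, (∃ q, q ≤ depth v ∧ par^[p] u = par^[q] v) ∧
      ∀ p' < p, ¬ ∃ q, q ≤ depth v ∧ par^[p'] u = par^[q] v :=
    ⟨Nat.find hex, Nat.find_spec hex, fun _ => Nat.find_min hex⟩
  obtain ⟨q, hqd, hpq⟩ := hp
  have hpi : p ≤ i := by
    by_contra hlt
    exact hmin i (by omega) ⟨j, by omega, hij⟩
  have hdepth (a b : ℕ) (hab : par^[a] u = par^[b] v) : depth u - a = depth v - b := by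
    rw [← h.depth_iterate, ← h.depth_iterate, hab]
  have h1 := hdepth _ _ hij
  have h2 := hdepth _ _ hpq
  have hne : ¬ (p = 0 ∧ q = 0) := by
    rintro ⟨rfl, rfl⟩
    exact huv hpq
  have hdisj : ∀ a < p, ∀ b, par^[a] u ≠ par^[b] v := by
    intro a ha b hab
    have := hdepth _ _ hab
    exact hmin a ha ⟨b, by omega, hab⟩
  rcases le_total p q with hle | hle
  · exact ⟨q, h.eq_of_meet_of_le hcyc hu hv (by omega) hle (by omega) hpq hdisj, by omega⟩
  · refine ⟨p, h.eq_of_meet_of_le hcyc hv hu (by omega) hle (by omega) hpq.symm ?_, by omega⟩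
    intro b hb a hab
    have := hdepth _ _ hab.symm
    exact hdisj a (by omega) b hab.symm

open Classical in
/-- The vertices reached from `S` by going up fewer than `m` levels, when counted with their
origin, are distinct. -/
theorem card_image_iterate (h : G.IsRootedTree root par depth) {S : Finset V} {m : ℕ}
    (hm : ∀ u ∈ S, m ≤ depth u)
    (hS : ∀ u ∈ S, ∀ v ∈ S, u ≠ v → ∀ i < m, ∀ j < m, par^[i] u ≠ par^[j] v) :
    ((S ×ˢ Finset.range m).image fun x => par^[x.2] x.1).card = S.card * m := by
  rw [Finset.card_image_of_injOn, Finset.card_product, Finset.card_range]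
  rintro ⟨u, i⟩ hu ⟨v, j⟩ hv huv
  simp only [Finset.coe_product, Set.mem_prod, Finset.mem_coe, Finset.mem_range] at hu hv huv
  by_cases hne : u = v
  · subst hne
    have := congrArg depth huv
    rw [h.depth_iterate, h.depth_iterate] at this
    have := hm u hu.1
    exact Prod.ext rfl (by dsimp only; omega)
  · exact absurd huv (hS u hu.1 v hv.1 hne i hu.2 j hv.2)

/-! ### Counting edges and back edges. -/

section Counting

variable [Fintype V]

theorem card_edgeFinset_le [Fintype G.edgeSet] [DecidablePred (IsBackEnd G par depth r)]
    (h : G.IsRootedTree root par depth)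
    (hnormal : ∀ x y, G.Adj x y → (∃ i, par^[i] x = y) ∨ ∃ i, par^[i] y = x)
    (hcyc : ∀ (v : V) (c : G.Walk v v), c.IsCycle → c.length = r) :
    G.edgeFinset.card + 1 ≤
      Fintype.card V + (Finset.univ.filter (IsBackEnd G par depth r)).card := by
  classical
  have hsub : G.edgeFinset ⊆ ((Finset.univ.erase root).image fun v => s(v, par v)) ∪
      (Finset.univ.filter (IsBackEnd G par depth r)).image fun v => s(v, par^[r - 1] v) := by
    have key (x y : V) (hxy : G.Adj x y) (hi : ∃ i, par^[i] x = y) :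
        s(x, y) ∈ ((Finset.univ.erase root).image fun v => s(v, par v)) ∪
          (Finset.univ.filter (IsBackEnd G par depth r)).image fun v => s(v, par^[r - 1] v) := by
      obtain ⟨hx, rfl | ⟨hb, rfl⟩⟩ := h.edge_cases hcyc hxy hi
      · exact Finset.mem_union_left _ (Finset.mem_image.2 ⟨x, by simpa using hx, rfl⟩)
      · exact Finset.mem_union_right _ (Finset.mem_image.2 ⟨x, by simpa using hb, rfl⟩)
    intro e
    induction e with
    | _ x y =>
      intro he
      rw [mem_edgeFinset, mem_edgeSet] at he
      rcases hnormal x y he with hi | hi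
      · exact key x y he hi
      · rw [Sym2.eq_swap]
        exact key y x he.symm hi
  have h1 := (Finset.card_le_card hsub).trans (Finset.card_union_le _ _)
  have h2 : ((Finset.univ.erase root).image fun v => s(v, par v)).card ≤ Fintype.card V - 1 := by
    refine Finset.card_image_le.trans ?_
    rw [Finset.card_erase_of_mem (Finset.mem_univ _), Finset.card_univ]
  have h3 : ((Finset.univ.filter (IsBackEnd G par depth r)).image
      fun v => s(v, par^[r - 1] v)).card ≤ (Finset.univ.filter (IsBackEnd G par depth r)).card :=
    Finset.card_image_le
  have h4 : 0 < Fintype.card V := Fintype.card_pos_iff.2 ⟨root⟩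
  omega

theorem card_backEnd_mul_le_of_odd [DecidablePred (IsBackEnd G par depth r)]
    (h : G.IsRootedTree root par depth)
    (hcyc : ∀ (v : V) (c : G.Walk v v), c.IsCycle → c.length = r) (hr : Odd r) :
    (Finset.univ.filter (IsBackEnd G par depth r)).card * (r - 1) + 1 ≤ Fintype.card V := by
  classical
  rw [← h.card_image_iterate (m := r - 1)]
  · refine Finset.card_lt_univ_of_notMem (x := root) fun hmem => ?_
    obtain ⟨⟨u, i⟩, hu, hi⟩ := Finset.mem_image.1 hmem
    simp only [Finset.mem_product, Finset.mem_filter, Finset.mem_univ, true_and,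
      Finset.mem_range] at hu
    have h1 := h.depth_iterate i u
    have h2 := hu.1.1
    rw [show par^[i] u = root from hi, h.depth_root] at h1
    omega
  · intro u hu
    exact (Finset.mem_filter.1 hu).2.1
  · intro u hu v hv huv i hi j hj hij
    obtain ⟨q, hq, -⟩ := h.exists_of_overlap hcyc (Finset.mem_filter.1 hu).2
      (Finset.mem_filter.1 hv).2 huv hi hj hij
    obtain ⟨k, hk⟩ := hr
    omega

theorem card_backEnd_mul_le_of_even [DecidablePred (IsBackEnd G par depth r)]
    (h : G.IsRootedTree root par depth)
    (hcyc : ∀ (v : V) (c : G.Walk v v), c.IsCycle → c.length = r)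
    (hrV : r ≤ Fintype.card V) {k : ℕ} (hk : 0 < k) (hr : r = 2 * k) :
    (Finset.univ.filter (IsBackEnd G par depth r)).card * (k - 1) + k + 1 ≤ Fintype.card V := by
  classical
  rcases (Finset.univ.filter (IsBackEnd G par depth r)).eq_empty_or_nonempty with hB | hB
  -- Without back edges the claim is k + 1 ≤ n, which follows from 2k ≤ n.
  · rw [hB, Finset.card_empty]
    omega
  obtain ⟨u₀, hu₀, hmin⟩ := Finset.exists_min_image _ depth hB
  have hu₀d := (Finset.mem_filter.1 hu₀).2.1
  -- The rest of the path of the shallowest back end `u₀`: levels k - 1 to 2k - 2 above it, just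
  -- short of its upper end.
  have hcard : ((Finset.range k).image fun i => par^[k - 1 + i] u₀).card = k := by
    rw [Finset.card_image_of_injOn, Finset.card_range]
    intro i hi j hj hij
    have := congrArg depth hij
    simp only [Finset.coe_range, Set.mem_Iio] at hi hj
    rw [h.depth_iterate, h.depth_iterate] at this
    omega
  have hlow := h.card_image_iterate (S := Finset.univ.filter (IsBackEnd G par depth r))
    (m := k - 1) (fun u hu => by have := (Finset.mem_filter.1 hu).2.1; omega) (by
      intro u hu v hv huv i hi j hj hij
      obtain ⟨q, hq, hle⟩ := h.exists_of_overlap hcyc (Finset.mem_filter.1 hu).2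
        (Finset.mem_filter.1 hv).2 huv (by omega) (by omega) hij
      omega)
  -- Minimality of `depth u₀` separates the sets: low blocks have depth above `depth u₀ - (k - 1)`,
  -- the extra vertices at most that.
  have hdisj : Disjoint (((Finset.univ.filter (IsBackEnd G par depth r)) ×ˢ
      Finset.range (k - 1)).image fun x => par^[x.2] x.1)
      ((Finset.range k).image fun i => par^[k - 1 + i] u₀) := by
    rw [Finset.disjoint_left]
    intro x hx hx'
    obtain ⟨⟨u, i⟩, hu, rfl⟩ := Finset.mem_image.1 hx
    obtain ⟨j, hj, hij⟩ := Finset.mem_image.1 hx'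
    rw [Finset.mem_product, Finset.mem_range] at hu
    have h1 := hmin u hu.1
    have h2 := congrArg depth hij
    rw [h.depth_iterate, h.depth_iterate] at h2
    have h3 := hu.2
    rw [Finset.mem_range] at hj
    dsimp only at h1 h2 h3
    omega
  rw [← hlow]
  nth_rewrite 2 [← hcard]
  rw [← Finset.card_union_of_disjoint hdisj]
  refine Finset.card_lt_univ_of_notMem (x := root) fun hmem => ?_
  rcases Finset.mem_union.1 hmem with hmem | hmem
  · obtain ⟨⟨u, i⟩, hu, hi⟩ := Finset.mem_image.1 hmem
    rw [Finset.mem_product, Finset.mem_range] at hu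
    have h1 := h.depth_iterate i u
    have h2 := (Finset.mem_filter.1 hu.1).2.1
    have h3 := hu.2
    rw [show par^[i] u = root from hi, h.depth_root] at h1
    dsimp only at h2 h3
    omega
  · obtain ⟨i, hi, hi'⟩ := Finset.mem_image.1 hmem
    have h1 := h.depth_iterate (k - 1 + i) u₀
    rw [hi', h.depth_root] at h1
    rw [Finset.mem_range] at hi
    omega

end Counting

end IsRootedTree

/-! ### Cycle lengths and the final bounds. -/

theorem Walk.IsCycle.length_le_card [Fintype V] {v : V} {c : G.Walk v v} (hc : c.IsCycle) :
    c.length ≤ Fintype.card V := by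
  have h1 := hc.isPath_tail.length_lt
  have h2 := Walk.length_tail_add_one hc.not_nil
  omega

theorem Walk.IsCycle.length_le_circumference [Fintype V] {v : V} {c : G.Walk v v}
    (hc : c.IsCycle) : c.length ≤ G.circumference := by
  -- Boundedness matters: the supremum of an unbounded set of naturals is 0 by default.
  refine le_csSup ⟨Fintype.card V, ?_⟩ ⟨v, c, hc, rfl⟩
  rintro _ ⟨w, d, hd, rfl⟩
  exact hd.length_le_card

end SimpleGraph

theorem mainTheorem5 {V : Type*} [Fintype V] (G : SimpleGraph V) [Fintype G.edgeSet]
    (hconn : G.Connected) (hplanar : G.IsPlanar) (hcycle : ¬ G.IsAcyclic)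
    (n r : ℕ) (hn : n = Fintype.card V)
    (hgirth : r = G.girth) (hcircum : r = G.circumference) :
    (Even r → 4 ≤ n →
      (G.edgeFinset.card : ℤ) ≤
        (n : ℤ) - 1 + ⌊((n : ℚ) - (r : ℚ) / 2 - 1) / ((r : ℚ) / 2 - 1)⌋) ∧
    (Odd r → 3 ≤ n →
      (G.edgeFinset.card : ℤ) ≤
        (n : ℤ) - 1 + ⌊((n : ℚ) - 1) / ((r : ℚ) - 1)⌋) := by
  classical
  have hcyc (v : V) (c : G.Walk v v) (hc : c.IsCycle) : c.length = r :=
    le_antisymm (hcircum ▸ hc.length_le_circumference)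
      (hgirth ▸ SimpleGraph.girth_le_length hc)
  have hr3 : 3 ≤ r := hgirth ▸ SimpleGraph.three_le_girth hcycle
  obtain ⟨root, c, hc, -⟩ := SimpleGraph.exists_girth_eq_length.2 hcycle
  have hrV : r ≤ Fintype.card V := hcyc _ c hc ▸ hc.length_le_card
  obtain ⟨par, depth, h, hnormal⟩ := hconn.exists_normal_isRootedTree root
  have hedge := h.card_edgeFinset_le hnormal hcyc
  have hodd := h.card_backEnd_mul_le_of_odd hcyc
  have heven (k : ℕ) (hk : 0 < k) (hr : r = 2 * k) := h.card_backEnd_mul_le_of_even hcyc hrV hk hr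
  rw [← hn] at hedge hodd heven
  generalize (Finset.univ.filter (SimpleGraph.IsRootedTree.IsBackEnd G par depth r)).card = b
    at hedge hodd heven
  refine ⟨fun hr _ => ?_, fun hr _ => ?_⟩
  · obtain ⟨k, hk⟩ := hr
    have hb := heven k (by omega) (by omega)
    have hfloor : (b : ℤ) ≤ ⌊((n : ℚ) - (r : ℚ) / 2 - 1) / ((r : ℚ) / 2 - 1)⌋ := by
      -- Since r ≥ 3 is even, k ≥ 2, so the denominator k - 1 is positive.
      have hk2 : (2 : ℚ) ≤ k := by exact_mod_cast (by omega : 2 ≤ k)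
      have hrk : (r : ℚ) / 2 = k := by rw [hk]; push_cast; ring
      rw [Int.le_floor, hrk, le_div_iff₀ (by linarith)]
      have hb' : ((b * (k - 1) + k + 1 : ℕ) : ℚ) ≤ n := by exact_mod_cast hb
      rw [Nat.cast_add, Nat.cast_add, Nat.cast_mul, Nat.cast_sub (by omega)] at hb'
      push_cast at hb' ⊢
      linarith
    omega
  · have hb := hodd hr
    have hfloor : (b : ℤ) ≤ ⌊((n : ℚ) - 1) / ((r : ℚ) - 1)⌋ := by
      have hr3' : (3 : ℚ) ≤ r := by exact_mod_cast hr3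
      rw [Int.le_floor, le_div_iff₀ (by linarith)]
      have hb' : ((b * (r - 1) + 1 : ℕ) : ℚ) ≤ n := by exact_mod_cast hb
      rw [Nat.cast_add, Nat.cast_mul, Nat.cast_sub (by omega)] at hb'
      push_cast at hb' ⊢
      linarith
    omega
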